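/- Let $N\ge 0$ be an integer and let $c\in\mathbb C$, $p_1,\dots,p_{2N}$, $c_1,\dots,c_{2N}$, $\xi_{10},\dots,\xi_{2N,0}\in\mathbb C$ satisfy $p_i\neq 0$ for all $i$, $p_i+p_j\ne 0$ for $i\neq j$, $c_{2N+1-i}=-c_i$ for all $i$, and $$p_i^{-3}+p_{2N+1-i}^{-3}=c\,(p_i^{-1}+p_{2N+1-i}^{-1})\qquad (i=1,\dots,2N).$$ Put $\xi_j=p_jy+p_j^{-1}s+\xi_{j0}$ and let $\tau(y,s)$ be the pfaffian of the skew-symmetric $2N\times 2N$ matrix with entries $$\delta_{j,2N+1-i}\,c_i+\frac{p_i-p_j}{p_i+p_j}\,e^{\xi_i+\xi_j}.$$ Then the two-component reduced Ostrovsky equation $$(u_t+uu_x)_x=3u+c(1-\rho),\qquad \rho_t+(\rho u)_x=0$$ has the $N$-soliton solution given in parametric form by $$u=-2(\ln\tau)_{ss},\qquad \rho=\bigl(1-2(\ln\tau)_{ys}\bigr)^{-1},\qquad x=y-2(\ln\tau)_s,\qquad t=s.$$ This means the following. Let $\Omega$ be the set of parameters $(y,s)\in\mathbb C^2$ with $\tau\neq0$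 and $1-2(\ln\tau)_{ys}\ne0$, where the derivatives of $\ln\tau$ are those of any local branch, so $(\ln\tau)_s=\tau_s/\tau$. Then $\Omega$ is open, the map $(y,s)\mapsto(x,t)$ is locally injective on $\Omega$, and for every open $W\subseteq\Omega$ on which this map is injective, its image $D$ is open and $u,\rho$, regarded as functions of $(x,t)\in D$, are smooth (holomorphic) and satisfy both equations on $D$. The same holds over the reals: if $c$ is real and $T=g\tau$ is real-valued for real $y,s$, for some constant $g\in\mathbb C\setminus\{0\}$ (for instance if all parameters are real and $g=1$), then all of the above is true with $T$ in place of $\tau$ and real variables $(y,s)$, $(x,t)$, smooth meaning $C^\infty$. -/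

import Mathlib

open scoped ContDiff

noncomputable section

/-- The pfaffian of a skew-symmetric `2n × 2n` matrix,
`Pf A = 1 / (2 ^ n n!) ∑ σ, sgn σ ∏ k, A (σ (2k-1)) (σ (2k))` (1-based indices). -/
def pfaffian {K : Type*} [Field K] {n : ℕ} (A : Matrix (Fin (2 * n)) (Fin (2 * n)) K) : K :=
  ((2 : K) ^ n * (n.factorial : K))⁻¹ *
    ∑ σ : Equiv.Perm (Fin (2 * n)), ((Equiv.Perm.sign σ : ℤ) : K) *
      ∏ k : Fin n, A (σ ⟨2 * k.1, by omega⟩) (σ ⟨2 * k.1 + 1, by omega⟩)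

/-- The phase `ξ_j = p_j y + p_j⁻¹ s + ξ_{j0}`. -/
def phase {m : ℕ} (p ξ₀ : Fin m → ℂ) (j : Fin m) (y s : ℂ) : ℂ :=
  p j * y + (p j)⁻¹ * s + ξ₀ j

/-- The `2N × 2N` matrix with entries
`δ_{j, 2N+1-i} a_i + (p_i - p_j) / (p_i + p_j) * exp (ξ_i + ξ_j)`;
the index reflection `i ↦ 2N+1-i` is `Fin.rev`. -/
def solitonMatrix {N : ℕ} (p a ξ₀ : Fin (2 * N) → ℂ) (y s : ℂ) :
    Matrix (Fin (2 * N)) (Fin (2 * N)) ℂ :=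
  Matrix.of fun i j =>
    (if j = Fin.rev i then a i else 0) +
      (p i - p j) / (p i + p j) * Complex.exp (phase p ξ₀ i y s + phase p ξ₀ j y s)

/-- The tau function of the `N`-soliton solution. -/
def solitonTau {N : ℕ} (p a ξ₀ : Fin (2 * N) → ℂ) (y s : ℂ) : ℂ :=
  pfaffian (solitonMatrix p a ξ₀ y s)

section Parametric

variable {𝕜 : Type*} [RCLike 𝕜]

/-- `(ln τ)_s`, which for every local branch of the logarithm is `τ_s / τ`. -/
def lnS (τ : 𝕜 → 𝕜 → 𝕜) (y s : 𝕜) : 𝕜 := logDeriv (fun s' => τ y s') s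

/-- `(ln τ)_{ss}`. -/
def lnSS (τ : 𝕜 → 𝕜 → 𝕜) (y s : 𝕜) : 𝕜 := deriv (fun s' => lnS τ y s') s

/-- `(ln τ)_{ys}`. -/
def lnYS (τ : 𝕜 → 𝕜 → 𝕜) (y s : 𝕜) : 𝕜 := deriv (fun y' => lnS τ y' s) y

/-- `u = -2 (ln τ)_{ss}` in the parameters `(y, s)`. -/
def paramU (τ : 𝕜 → 𝕜 → 𝕜) (y s : 𝕜) : 𝕜 := -2 * lnSS τ y s

/-- `ρ = (1 - 2 (ln τ)_{ys})⁻¹` in the parameters `(y, s)`. -/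
def paramRho (τ : 𝕜 → 𝕜 → 𝕜) (y s : 𝕜) : 𝕜 := (1 - 2 * lnYS τ y s)⁻¹

/-- The hodograph map `(y, s) ↦ (x, t) = (y - 2 (ln τ)_s, s)`. -/
def hodograph (τ : 𝕜 → 𝕜 → 𝕜) (q : 𝕜 × 𝕜) : 𝕜 × 𝕜 := (q.1 - 2 * lnS τ q.1 q.2, q.2)

/-- The parameters `(y, s)` at which the formulas make sense: `τ` and `1 - 2 (ln τ)_{ys}`
do not vanish. -/
def regularSet (τ : 𝕜 → 𝕜 → 𝕜) : Set (𝕜 × 𝕜) :=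
  {q | τ q.1 q.2 ≠ 0 ∧ 1 - 2 * lnYS τ q.1 q.2 ≠ 0}

/-- `(u, ρ)` is a smooth solution, on the open set `D` of the `(x, t)`-plane, of
`(u_t + u u_x)_x = 3 u + c (1 - ρ)`, `ρ_t + (ρ u)_x = 0`. -/
structure IsSolutionOn (c : 𝕜) (D : Set (𝕜 × 𝕜)) (u ρ : 𝕜 → 𝕜 → 𝕜) : Prop where
  isOpen : IsOpen D
  smooth_u : ContDiffOn 𝕜 ∞ (fun z : 𝕜 × 𝕜 => u z.1 z.2) D
  smooth_rho : ContDiffOn 𝕜 ∞ (fun z : 𝕜 × 𝕜 => ρ z.1 z.2) D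
  momentum : ∀ x t, (x, t) ∈ D →
    deriv (fun x' => deriv (fun t' => u x' t') t + u x' t * deriv (fun x'' => u x'' t) x') x
      = 3 * u x t + c * (1 - ρ x t)
  continuity : ∀ x t, (x, t) ∈ D →
    deriv (fun t' => ρ x t') t + deriv (fun x' => ρ x' t * u x' t) x = 0

/-- `τ` gives a solution in parametric form: on the open set of regular parameters the hodograph
map is locally injective, and on every open set `W` of regular parameters on which it is
injective, `u` and `ρ` are, as functions of `(x, t)`, a smooth solution on the image of `W`. -/
structure IsParametricSolution (c : 𝕜) (τ : 𝕜 → 𝕜 → 𝕜) : Prop where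
  isOpen : IsOpen (regularSet τ)
  locally_injective : ∀ q ∈ regularSet τ, ∃ W : Set (𝕜 × 𝕜),
    IsOpen W ∧ q ∈ W ∧ W ⊆ regularSet τ ∧ Set.InjOn (hodograph τ) W
  solution : ∀ W : Set (𝕜 × 𝕜), IsOpen W → W ⊆ regularSet τ → Set.InjOn (hodograph τ) W →
    ∃ u ρ : 𝕜 → 𝕜 → 𝕜,
      (∀ y s, (y, s) ∈ W → u (y - 2 * lnS τ y s) s = paramU τ y s ∧
        ρ (y - 2 * lnS τ y s) s = paramRho τ y s) ∧
      IsSolutionOn c (hodograph τ '' W) u ρ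

end Parametric

end

/-! Write `τ = Pf A` and `φ_n = (p_i^(-n) exp ξ_i)_i`. The factor `(p_i - p_j)/(p_i + p_j)` makes
both derivatives of `A` rank-two: `A_s = φ_0 φ_1ᵀ - φ_1 φ_0ᵀ` and `A_y = φ_{-1} φ_0ᵀ - φ_0 φ_{-1}ᵀ`.
By Jacobi's formula for pfaffians (`hasDerivAt_pfaffian`), `ℓ = (ln τ)_s` equals `W(1,0)`, where
`W(m,n) = φ_mᵀ A⁻¹ φ_n` is skew in `m, n`. Derivatives of the `W(m,n)` are again quadratic
polynomials in them.

The condition on the `p_i` enters once, through `E = diag(p_i⁻³ - c p_i⁻¹)`: in `EA + AE` the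
antidiagonal constants cancel, and the trace against `A⁻¹` shows that `W(3,0) - 2 W(2,1) - c W(1,0)`
is constant (`wavePairing_reduction`). Its `y`-derivative is the bilinear equation `ℓ_yss + 6 ℓ_y
ℓ_s - 3 ℓ_s - c ℓ_y = 0`, that is, `(D_y D_s³ - 3 D_s² - c D_y D_s) τ·τ = 0`.

For `x = y - 2ℓ`, `t = s` one has `x_y = 1/ρ` and `x_s = u`, so `∂_x = ρ ∂_y` and `∂_t + u ∂_x =
∂_s`. The continuity equation becomes `x_ys = x_sy`, and the momentum equation becomes the bilinear
one. The inverse function theorem provides the passage to `(x, t)`. Over the reals only the bilinear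
equation has to be transferred. -/

/-! ### Pfaffians under congruence. -/

section PfaffianAlgebra

/-- A function on `Fin (2 * n)` as a family of `n` pairs of consecutive values. -/
def consecutivePairs (n : ℕ) (X : Type*) : (Fin (2 * n) → X) ≃ (Fin n → Fin 2 → X) :=
  (Equiv.arrowCongr ((finCongr (Nat.mul_comm 2 n)).trans finProdFinEquiv.symm)
    (Equiv.refl X)).trans (Equiv.curry _ _ _)

theorem consecutivePairs_zero {n : ℕ} {X : Type*} (f : Fin (2 * n) → X) (k : Fin n) :
    consecutivePairs n X f k 0 = f ⟨2 * k.1, by omega⟩ := by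
  simp [consecutivePairs, Equiv.arrowCongr, finProdFinEquiv]

theorem consecutivePairs_one {n : ℕ} {X : Type*} (f : Fin (2 * n) → X) (k : Fin n) :
    consecutivePairs n X f k 1 = f ⟨2 * k.1 + 1, by omega⟩ := by
  simp [consecutivePairs, Equiv.arrowCongr, finProdFinEquiv]
  congr 1
  ext
  simp [Nat.add_comm]

theorem Fin.prod_univ_two_mul_eq {M : Type*} [CommMonoid M] {n : ℕ} (f : Fin (2 * n) → M) :
    ∏ m, f m = ∏ k : Fin n, f ⟨2 * k.1, by omega⟩ * f ⟨2 * k.1 + 1, by omega⟩ := by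
  have h : ∏ m, f m = ∏ x : Fin n × Fin 2, consecutivePairs n M f x.1 x.2 :=
    Fintype.prod_equiv ((finCongr (Nat.mul_comm 2 n)).trans finProdFinEquiv.symm) _ _
      fun m => (congrArg f (Equiv.symm_apply_apply
        ((finCongr (Nat.mul_comm 2 n)).trans finProdFinEquiv.symm) m)).symm
  rw [h, Fintype.prod_prod_type]
  exact Finset.prod_congr rfl fun k _ => by
    rw [Fin.prod_univ_two, consecutivePairs_zero, consecutivePairs_one]

variable {K : Type*} [Field K] {n : ℕ}

theorem prod_congruence_apply (A B : Matrix (Fin (2 * n)) (Fin (2 * n)) K)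
    (r : Fin (2 * n) → Fin (2 * n)) :
    ∏ k : Fin n, (B * A * B.transpose) (r ⟨2 * k.1, by omega⟩) (r ⟨2 * k.1 + 1, by omega⟩) =
      ∑ f : Fin (2 * n) → Fin (2 * n),
        (∏ k : Fin n, A (f ⟨2 * k.1, by omega⟩) (f ⟨2 * k.1 + 1, by omega⟩)) *
          ∏ m, B (r m) (f m) := by
  have h : ∀ a b, (B * A * B.transpose) a b =
      ∑ x : Fin 2 → Fin (2 * n), A (x 0) (x 1) * (B a (x 0) * B b (x 1)) := by
    intro a b
    rw [← (finTwoArrowEquiv (Fin (2 * n))).symm.sum_comp, Fintype.sum_prod_type_right]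
    simp only [Matrix.mul_apply, Matrix.transpose_apply, Finset.sum_mul]
    refine Finset.sum_congr rfl fun i _ => Finset.sum_congr rfl fun j _ => ?_
    simp [finTwoArrowEquiv]
    ring
  simp only [h]
  rw [Finset.prod_univ_sum, Fintype.piFinset_univ]
  refine (Fintype.sum_equiv (consecutivePairs n _) _ _ fun f => ?_).symm
  rw [Fin.prod_univ_two_mul_eq, ← Finset.prod_mul_distrib]
  exact Finset.prod_congr rfl fun k _ => by rw [consecutivePairs_zero, consecutivePairs_one]

/-- Expanding the entries over all maps `f` and summing over `σ` first leaves the determinant of `B`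
with columns selected by `f`. It vanishes for non-injective `f` and is `sgn f · det B` for
permutations. Skewness of `A` plays no role. -/
theorem pfaffian_congruence (A B : Matrix (Fin (2 * n)) (Fin (2 * n)) K) :
    pfaffian (B * A * B.transpose) = B.det * pfaffian A := by
  unfold pfaffian
  rw [mul_left_comm]
  congr 1
  simp only [prod_congruence_apply A B, Finset.mul_sum]
  rw [Finset.sum_comm]
  have h : ∀ f : Fin (2 * n) → Fin (2 * n),
      ∑ σ : Equiv.Perm (Fin (2 * n)), ((Equiv.Perm.sign σ : ℤ) : K) *
        ((∏ k : Fin n, A (f ⟨2 * k.1, by omega⟩) (f ⟨2 * k.1 + 1, by omega⟩)) *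
          ∏ m, B (σ m) (f m)) =
      (∏ k : Fin n, A (f ⟨2 * k.1, by omega⟩) (f ⟨2 * k.1 + 1, by omega⟩)) *
        (B.submatrix id f).det := by
    intro f
    rw [Matrix.det_apply', Finset.mul_sum]
    refine Finset.sum_congr rfl fun σ _ => ?_
    simp only [Matrix.submatrix_apply, id]
    ring
  simp only [h]
  refine (Finset.sum_of_injOn (fun σ : Equiv.Perm (Fin (2 * n)) => (σ : Fin (2 * n) → _))
    (fun σ _ τ _ e => DFunLike.coe_injective e) (by simp) ?_ ?_).symm
  · intro f _ hf
    have hinj : ¬ Function.Injective f := fun hi =>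
      hf ⟨Equiv.ofBijective f (Finite.injective_iff_bijective.1 hi), by simp, rfl⟩
    simp only [Function.Injective, not_forall] at hinj
    obtain ⟨i, j, hij, hne⟩ := hinj
    rw [Matrix.det_zero_of_column_eq hne (fun k => by simp [hij]), mul_zero]
  · intro σ _
    rw [Matrix.det_permute']
    ring

/-- A congruence moves a kernel vector into the basis, giving a matrix with a zero row and column;
this avoids `Pf² = det`. It makes `A` invertible wherever `τ ≠ 0`. -/
theorem pfaffian_eq_zero_of_det_eq_zero {A : Matrix (Fin (2 * n)) (Fin (2 * n)) K}
    (hA : A.transpose = -A) (hdet : A.det = 0) : pfaffian A = 0 := by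
  obtain ⟨v, hv, hAv⟩ := Matrix.exists_mulVec_eq_zero_iff.2 hdet
  obtain ⟨i, hi⟩ := Function.ne_iff.1 hv
  -- Row `i` of `B * A * Bᵀ` is `vᵀ A Bᵀ = 0`, while `det B = v i ≠ 0`.
  set B : Matrix (Fin (2 * n)) (Fin (2 * n)) K := Matrix.updateRow 1 i v with hB
  have hBdet : B.det = v i := by
    rw [hB, ← Matrix.cramer_transpose_apply, Matrix.transpose_one, Matrix.cramer_one]
    rfl
  have hvA : Matrix.vecMul v A = 0 := by
    rw [← Matrix.mulVec_transpose, hA, Matrix.neg_mulVec, hAv, neg_zero]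
  have hrow : ∀ j, (B * A * B.transpose) i j = 0 := by
    intro j
    have : (B * A) i = 0 := by
      rw [Matrix.mul_apply_eq_vecMul, hB, Matrix.updateRow_self, hvA]
    rw [Matrix.mul_apply]
    simp [this]
  have hcol : ∀ j, (B * A * B.transpose) j i = 0 := by
    intro j
    have h1 : (B * A * B.transpose).transpose = -(B * A * B.transpose) := by
      simp [Matrix.transpose_mul, hA, Matrix.mul_assoc]
    have h2 := congrFun (congrFun h1 i) j
    rw [Matrix.transpose_apply, Matrix.neg_apply, hrow, neg_zero] at h2
    exact h2
  have hzero : pfaffian (B * A * B.transpose) = 0 := by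
    unfold pfaffian
    refine mul_eq_zero_of_right _ (Finset.sum_eq_zero fun σ _ => mul_eq_zero_of_right _ ?_)
    obtain ⟨m, hm⟩ := σ.surjective i
    -- The position `m` with `σ m = i` lies in pair `m / 2`, as first or second member according to
    -- parity.
    refine Finset.prod_eq_zero (Finset.mem_univ (⟨m.1 / 2, by omega⟩ : Fin n)) ?_
    rcases Nat.mod_two_eq_zero_or_one m.1 with h | h
    · have : (⟨2 * (m.1 / 2), by omega⟩ : Fin (2 * n)) = m := Fin.ext (by simp; omega)
      simp only [this, hm, hrow]
    · have : (⟨2 * (m.1 / 2) + 1, by omega⟩ : Fin (2 * n)) = m := Fin.ext (by simp; omega)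
      simp only [this, hm, hcol]
  rw [pfaffian_congruence, hBdet] at hzero
  exact (mul_eq_zero.1 hzero).resolve_left hi

end PfaffianAlgebra

/-! ### Derivatives of pfaffians and inverses along curves of matrices. -/

section MatrixCurves

open Matrix

/-- The order of quantifiers matters: `d` depends only on value and velocity, so the curve may be
exchanged for a more convenient one. -/
theorem exists_hasDerivAt_pfaffian {n : ℕ} (A A' : Matrix (Fin (2 * n)) (Fin (2 * n)) ℂ) :
    ∃ d : ℂ, ∀ (B : ℂ → Matrix (Fin (2 * n)) (Fin (2 * n)) ℂ) (s : ℂ), B s = A →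
      (∀ i j, HasDerivAt (fun t => B t i j) (A' i j) s) →
      HasDerivAt (fun t => pfaffian (B t)) d s := by
  refine ⟨((2 : ℂ) ^ n * (n.factorial : ℂ))⁻¹ *
    ∑ σ : Equiv.Perm (Fin (2 * n)), ((Equiv.Perm.sign σ : ℤ) : ℂ) *
      ∑ k : Fin n, (∏ l ∈ Finset.univ.erase k,
        A (σ ⟨2 * l.1, by omega⟩) (σ ⟨2 * l.1 + 1, by omega⟩)) •
          A' (σ ⟨2 * k.1, by omega⟩) (σ ⟨2 * k.1 + 1, by omega⟩), ?_⟩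
  rintro B s rfl hB
  unfold pfaffian
  exact (HasDerivAt.fun_sum fun σ _ =>
    (HasDerivAt.fun_finsetProd fun k _ => hB _ _).const_mul _).const_mul _

theorem hasDerivAt_det_one_add_smul {m : ℕ} (M : Matrix (Fin m) (Fin m) ℂ) (s : ℂ) :
    HasDerivAt (fun t => (1 + (t - s) • M).det) M.trace s := by
  rw [funext fun t => det_one_add_smul (t - s) M]
  set P := (det (1 + (Polynomial.X : Polynomial ℂ) • M.map Polynomial.C)).divX.divX
  have hs : HasDerivAt (fun t : ℂ => t - s) 1 s := (hasDerivAt_id s).sub_const s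
  have hP : HasDerivAt (fun t : ℂ => P.eval (t - s)) (P.derivative.eval (s - s) * 1) s :=
    HasDerivAt.comp (h := fun t => t - s) s (P.hasDerivAt (s - s)) hs
  refine (((hs.const_mul M.trace).const_add 1).add (hP.mul (hs.pow 2))).congr_deriv ?_
  simp

/-- The curve is replaced by a congruence orbit `(1 + (t-s)M) A (1 + (t-s)M)ᵀ` with the same
velocity, along which the pfaffian is `det (1 + (t-s)M) · Pf A`. -/
theorem hasDerivAt_pfaffian {n : ℕ} {B : ℂ → Matrix (Fin (2 * n)) (Fin (2 * n)) ℂ}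
    {B' : Matrix (Fin (2 * n)) (Fin (2 * n)) ℂ} {s : ℂ} (hskew : (B s).transpose = -B s)
    (hskew' : B'.transpose = -B') (hdet : (B s).det ≠ 0)
    (hB : ∀ i j, HasDerivAt (fun t => B t i j) (B' i j) s) :
    HasDerivAt (fun t => pfaffian (B t))
      (((B s)⁻¹ * B').trace / 2 * pfaffian (B s)) s := by
  obtain ⟨d, hd⟩ := exists_hasDerivAt_pfaffian (B s) B'
  have hu : IsUnit (B s).det := isUnit_iff_ne_zero.2 hdet
  set A := B s
  -- The factor 1/2 is needed because `M A` and `A Mᵀ` each contribute half of `B'`.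
  set M : Matrix (Fin (2 * n)) (Fin (2 * n)) ℂ := (1 / 2 : ℂ) • (B' * A⁻¹) with hM
  have hinv : (A⁻¹).transpose = -A⁻¹ := by
    rw [transpose_nonsing_inv, hskew]
    refine inv_eq_right_inv ?_
    rw [neg_mul_neg, mul_nonsing_inv _ hu]
  have hsum : M * A + A * M.transpose = B' := by
    rw [hM, transpose_smul, transpose_mul, hinv, hskew', neg_mul_neg, Matrix.smul_mul, Matrix.mul_smul,
      Matrix.mul_assoc, nonsing_inv_mul _ hu, ← Matrix.mul_assoc, mul_nonsing_inv _ hu,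
      Matrix.mul_one, Matrix.one_mul, ← add_smul]
    norm_num
  have hexp : ∀ t, (1 + (t - s) • M) * A * (1 + (t - s) • M).transpose =
      A + (t - s) • B' + (t - s) ^ 2 • (M * A * M.transpose) := by
    intro t
    rw [← hsum]
    simp only [transpose_add, transpose_one, transpose_smul, Matrix.add_mul, Matrix.mul_add,
      Matrix.one_mul, Matrix.mul_one, Matrix.smul_mul, Matrix.mul_smul, smul_add, smul_smul, pow_two]
    abel
  have hs : HasDerivAt (fun t : ℂ => t - s) 1 s := (hasDerivAt_id s).sub_const s
  have h1 : HasDerivAt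
      (fun t => pfaffian ((1 + (t - s) • M) * A * (1 + (t - s) • M).transpose)) d s := by
    refine hd _ s (by simp) fun i j => ?_
    simp only [hexp, Matrix.add_apply, Matrix.smul_apply, smul_eq_mul]
    refine (((hs.mul_const (B' i j)).const_add (A i j)).add
      ((hs.pow 2).mul_const ((M * A * M.transpose) i j))).congr_deriv ?_
    simp
  simp only [pfaffian_congruence] at h1
  have h2 := h1.unique ((hasDerivAt_det_one_add_smul M s).mul_const (pfaffian A))
  have h3 : M.trace = (A⁻¹ * B').trace / 2 := by
    rw [hM, trace_smul, trace_mul_comm, smul_eq_mul]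
    ring
  rw [← h3, ← h2]
  exact hd B s rfl hB

variable {m : ℕ} {A : ℂ → Matrix (Fin m) (Fin m) ℂ} {A' : Matrix (Fin m) (Fin m) ℂ} {s : ℂ}

theorem differentiableAt_det (hA : ∀ i j, DifferentiableAt ℂ (fun t => A t i j) s) :
    DifferentiableAt ℂ (fun t => (A t).det) s := by
  simp only [det_apply']
  exact DifferentiableAt.fun_sum fun σ _ =>
    (DifferentiableAt.fun_finsetProd fun i _ => hA _ _).const_mul _

theorem differentiableAt_inv_apply (hA : ∀ i j, DifferentiableAt ℂ (fun t => A t i j) s)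
    (hdet : (A s).det ≠ 0) (i j : Fin m) : DifferentiableAt ℂ (fun t => (A t)⁻¹ i j) s := by
  simp only [inv_def, Matrix.smul_apply, adjugate_apply, Ring.inverse_eq_inv', smul_eq_mul]
  refine ((differentiableAt_det hA).inv hdet).mul (differentiableAt_det fun k l => ?_)
  by_cases hk : k = j
  · subst hk
    simp only [updateRow_self]
    exact differentiableAt_const _
  · simpa only [updateRow_ne hk] using hA k l

theorem hasDerivAt_inv_apply (hA : ∀ i j, HasDerivAt (fun t => A t i j) (A' i j) s)
    (hdet : (A s).det ≠ 0) (i j : Fin m) :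
    HasDerivAt (fun t => (A t)⁻¹ i j) ((-((A s)⁻¹ * A' * (A s)⁻¹)) i j) s := by
  have hd := fun i j => (hA i j).differentiableAt
  have hu : IsUnit (A s).det := isUnit_iff_ne_zero.2 hdet
  -- Cramer's rule gives differentiability; the value of the derivative then follows by
  -- differentiating `A A⁻¹ = 1`.
  set D : Matrix (Fin m) (Fin m) ℂ := of fun i j => deriv (fun t => (A t)⁻¹ i j) s with hD
  have hDd : ∀ i j, HasDerivAt (fun t => (A t)⁻¹ i j) (D i j) s := fun i j =>
    (differentiableAt_inv_apply hd hdet i j).hasDerivAt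
  have hone : A' * (A s)⁻¹ + A s * D = 0 := by
    ext i k
    have h1 : HasDerivAt (fun t => ∑ j, A t i j * (A t)⁻¹ j k)
        (∑ j, (A' i j * (A s)⁻¹ j k + A s i j * D j k)) s :=
      HasDerivAt.fun_sum fun j _ => (hA i j).mul (hDd j k)
    have h2 : (fun t => ∑ j, A t i j * (A t)⁻¹ j k) =ᶠ[nhds s]
        fun _ => (1 : Matrix (Fin m) (Fin m) ℂ) i k := by
      filter_upwards [(differentiableAt_det hd).continuousAt.eventually_ne hdet] with t ht
      rw [← Matrix.mul_apply, mul_nonsing_inv _ (isUnit_iff_ne_zero.2 ht)]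
    have h3 := (h1.congr_of_eventuallyEq h2.symm).unique (hasDerivAt_const s _)
    rw [Finset.sum_add_distrib] at h3
    exact h3
  have hDeq : D = -((A s)⁻¹ * A' * (A s)⁻¹) := by
    rw [Matrix.mul_assoc, eq_neg_of_add_eq_zero_left hone, Matrix.mul_neg, neg_neg,
      ← Matrix.mul_assoc, nonsing_inv_mul _ hu, Matrix.one_mul]
  rw [← hDeq]
  exact hDd i j

/-- In `-A⁻¹ A' A⁻¹` the rank-two `A'` splits each pairing into a product of two pairings. -/
theorem hasDerivAt_dotProduct_inv_mulVec {v w : ℂ → Fin m → ℂ} {v' w' a b : Fin m → ℂ}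
    (hA : ∀ i j, HasDerivAt (fun t => A t i j) ((vecMulVec a b - vecMulVec b a) i j) s)
    (hv : ∀ i, HasDerivAt (fun t => v t i) (v' i) s)
    (hw : ∀ i, HasDerivAt (fun t => w t i) (w' i) s) (hdet : (A s).det ≠ 0) :
    HasDerivAt (fun t => v t ⬝ᵥ (A t)⁻¹ *ᵥ w t)
      (v' ⬝ᵥ (A s)⁻¹ *ᵥ w s + v s ⬝ᵥ (A s)⁻¹ *ᵥ w' -
        (v s ⬝ᵥ (A s)⁻¹ *ᵥ a) * (b ⬝ᵥ (A s)⁻¹ *ᵥ w s) +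
        (v s ⬝ᵥ (A s)⁻¹ *ᵥ b) * (a ⬝ᵥ (A s)⁻¹ *ᵥ w s)) s := by
  have h : HasDerivAt (fun t => ∑ i, v t i * ∑ j, (A t)⁻¹ i j * w t j)
      (∑ i, (v' i * ∑ j, (A s)⁻¹ i j * w s j + v s i * ∑ j,
        ((-((A s)⁻¹ * (vecMulVec a b - vecMulVec b a) * (A s)⁻¹)) i j * w s j +
          (A s)⁻¹ i j * w' j))) s :=
    HasDerivAt.fun_sum fun i _ => (hv i).mul <| HasDerivAt.fun_sum fun j _ =>
      (hasDerivAt_inv_apply hA hdet i j).mul (hw j)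
  refine h.congr_deriv ?_
  have hab : ∀ a b : Fin m → ℂ, v s ⬝ᵥ ((A s)⁻¹ * vecMulVec a b * (A s)⁻¹) *ᵥ w s =
      (v s ⬝ᵥ (A s)⁻¹ *ᵥ a) * (b ⬝ᵥ (A s)⁻¹ *ᵥ w s) := by
    intro a b
    rw [← mulVec_mulVec, ← mulVec_mulVec, vecMulVec_mulVec, mulVec_smul, dotProduct_smul]
    simp
  simp only [Finset.sum_add_distrib, mul_add]
  change v' ⬝ᵥ (A s)⁻¹ *ᵥ w s +
    (v s ⬝ᵥ (-((A s)⁻¹ * (vecMulVec a b - vecMulVec b a) * (A s)⁻¹)) *ᵥ w s +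
      v s ⬝ᵥ (A s)⁻¹ *ᵥ w') = _
  rw [Matrix.mul_sub, Matrix.sub_mul, neg_mulVec, sub_mulVec, dotProduct_neg, dotProduct_sub,
    hab, hab]
  ring

end MatrixCurves

/-! ### Partial derivatives and the bilinear equation. -/

section PartialDerivatives

variable {𝕜 : Type*} [RCLike 𝕜]

/-- The partial derivative in the first variable. -/
noncomputable def partialY (f : 𝕜 × 𝕜 → 𝕜) (q : 𝕜 × 𝕜) : 𝕜 := deriv (fun y => f (y, q.2)) q.1

/-- The partial derivative in the second variable. -/
noncomputable def partialS (f : 𝕜 × 𝕜 → 𝕜) (q : 𝕜 × 𝕜) : 𝕜 := deriv (fun s => f (q.1, s)) q.2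

/-- `(ln τ)_s` as a function on the plane. -/
noncomputable def logS (τ : 𝕜 → 𝕜 → 𝕜) (q : 𝕜 × 𝕜) : 𝕜 := lnS τ q.1 q.2

theorem IsOpen.eventually_mk_left_mem {U : Set (𝕜 × 𝕜)} (hU : IsOpen U) {q : 𝕜 × 𝕜}
    (hq : q ∈ U) : ∀ᶠ y in nhds q.1, (y, q.2) ∈ U :=
  (hU.preimage (by fun_prop : Continuous fun y : 𝕜 => (y, q.2))).mem_nhds hq

theorem IsOpen.eventually_mk_right_mem {U : Set (𝕜 × 𝕜)} (hU : IsOpen U) {q : 𝕜 × 𝕜}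
    (hq : q ∈ U) : ∀ᶠ s in nhds q.2, (q.1, s) ∈ U :=
  (hU.preimage (by fun_prop : Continuous fun s : 𝕜 => (q.1, s))).mem_nhds hq

theorem Set.EqOn.partialY {U : Set (𝕜 × 𝕜)} {f g : 𝕜 × 𝕜 → 𝕜} (h : Set.EqOn f g U)
    (hU : IsOpen U) : Set.EqOn (partialY f) (partialY g) U := fun _ hq =>
  Filter.EventuallyEq.deriv_eq <| (hU.eventually_mk_left_mem hq).mono fun _ hy => h hy

theorem Set.EqOn.partialS {U : Set (𝕜 × 𝕜)} {f g : 𝕜 × 𝕜 → 𝕜} (h : Set.EqOn f g U)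
    (hU : IsOpen U) : Set.EqOn (partialS f) (partialS g) U := fun _ hq =>
  Filter.EventuallyEq.deriv_eq <| (hU.eventually_mk_right_mem hq).mono fun _ hs => h hs

/-- The equation satisfied by `(ln τ)_s` that amounts to the bilinear equation for `τ`. -/
def SatisfiesBilinear (c : 𝕜) (τ : 𝕜 → 𝕜 → 𝕜) : Prop :=
  ∀ q : 𝕜 × 𝕜, τ q.1 q.2 ≠ 0 →
    partialY (partialS (partialS (logS τ))) q +
      6 * partialY (logS τ) q * partialS (logS τ) q -
      3 * partialS (logS τ) q - c * partialY (logS τ) q = 0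

end PartialDerivatives

/-! ### The soliton tau function satisfies the bilinear equation. -/

section Soliton

open Matrix

variable {N : ℕ} (p a ξ₀ : Fin (2 * N) → ℂ)

/-- The vector `(p_i ^ (-n) exp ξ_i)_i`. -/
noncomputable def waveVector (n : ℤ) (y s : ℂ) (i : Fin (2 * N)) : ℂ :=
  p i ^ (-n) * Complex.exp (phase p ξ₀ i y s)

/-- The bilinear pairing of two wave vectors through the inverse of the soliton matrix. -/
noncomputable def wavePairing (m n : ℤ) (q : ℂ × ℂ) : ℂ :=
  waveVector p ξ₀ m q.1 q.2 ⬝ᵥ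
    (solitonMatrix p a ξ₀ q.1 q.2)⁻¹ *ᵥ waveVector p ξ₀ n q.1 q.2

variable {p a ξ₀}

theorem solitonMatrix_transpose (ha : ∀ i, a (Fin.rev i) = -a i) (y s : ℂ) :
    (solitonMatrix p a ξ₀ y s).transpose = -solitonMatrix p a ξ₀ y s := by
  ext i j
  simp only [solitonMatrix, transpose_apply, of_apply, Matrix.neg_apply]
  have h1 : (if i = Fin.rev j then a j else 0) = -(if j = Fin.rev i then a i else 0) := by
    by_cases h : j = Fin.rev i
    · subst h
      simp [ha]
    · have h' : ¬ i = Fin.rev j := fun e => h (by rw [e, Fin.rev_rev])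
      simp [h, h']
  rw [h1, add_comm (phase p ξ₀ j y s), add_comm (p j), ← neg_sub (p i)]
  ring

theorem hasDerivAt_waveVector_s (hp : ∀ i, p i ≠ 0) (n : ℤ) (y s : ℂ) (i : Fin (2 * N)) :
    HasDerivAt (fun t => waveVector p ξ₀ n y t i) (waveVector p ξ₀ (n + 1) y s i) s := by
  have h : HasDerivAt (fun t => phase p ξ₀ i y t) ((p i)⁻¹) s := by
    unfold phase
    simpa using (((hasDerivAt_id s).const_mul (p i)⁻¹).const_add (p i * y)).add_const (ξ₀ i)
  refine (h.cexp.const_mul (p i ^ (-n))).congr_deriv ?_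
  rw [waveVector, neg_add, zpow_add₀ (hp i), _root_.zpow_neg_one]
  ring

theorem hasDerivAt_waveVector_y (hp : ∀ i, p i ≠ 0) (n : ℤ) (y s : ℂ) (i : Fin (2 * N)) :
    HasDerivAt (fun t => waveVector p ξ₀ n t s i) (waveVector p ξ₀ (n - 1) y s i) y := by
  have h : HasDerivAt (fun t => phase p ξ₀ i t s) (p i) y := by
    unfold phase
    simpa using (((hasDerivAt_id y).const_mul (p i)).add_const ((p i)⁻¹ * s)).add_const (ξ₀ i)
  refine (h.cexp.const_mul (p i ^ (-n))).congr_deriv ?_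
  rw [waveVector, neg_sub, sub_eq_add_neg, zpow_add₀ (hp i), zpow_one]
  ring

theorem div_mul_add_inv (hp : ∀ i, p i ≠ 0) (hpp : ∀ i j, i ≠ j → p i + p j ≠ 0)
    (i j : Fin (2 * N)) :
    (p i - p j) / (p i + p j) * ((p i)⁻¹ + (p j)⁻¹) = (p j)⁻¹ - (p i)⁻¹ := by
  by_cases hij : i = j
  · simp [hij]
  · have := hpp i j hij
    have := hp i
    have := hp j
    field_simp
    ring

theorem div_mul_add (hpp : ∀ i j, i ≠ j → p i + p j ≠ 0) (i j : Fin (2 * N)) :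
    (p i - p j) / (p i + p j) * (p i + p j) = p i - p j := by
  by_cases hij : i = j
  · simp [hij]
  · exact div_mul_cancel₀ _ (hpp i j hij)

theorem hasDerivAt_solitonMatrix_s (hp : ∀ i, p i ≠ 0) (hpp : ∀ i j, i ≠ j → p i + p j ≠ 0)
    (y s : ℂ) (i j : Fin (2 * N)) :
    HasDerivAt (fun t => solitonMatrix p a ξ₀ y t i j)
      ((vecMulVec (waveVector p ξ₀ 0 y s) (waveVector p ξ₀ 1 y s) -
        vecMulVec (waveVector p ξ₀ 1 y s) (waveVector p ξ₀ 0 y s)) i j) s := by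
  have h : ∀ i, HasDerivAt (fun t => phase p ξ₀ i y t) ((p i)⁻¹) s := by
    intro i
    unfold phase
    simpa using (((hasDerivAt_id s).const_mul (p i)⁻¹).const_add (p i * y)).add_const (ξ₀ i)
  refine ((((h i).fun_add (h j)).cexp.const_mul ((p i - p j) / (p i + p j))).const_add
    (if j = Fin.rev i then a i else 0)).congr_deriv ?_
  simp only [Matrix.sub_apply, vecMulVec_apply, waveVector, Complex.exp_add, neg_zero, zpow_zero,
    _root_.zpow_neg_one]
  linear_combination Complex.exp (phase p ξ₀ i y s) * Complex.exp (phase p ξ₀ j y s) *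
    div_mul_add_inv hp hpp i j

theorem hasDerivAt_solitonMatrix_y (hpp : ∀ i j, i ≠ j → p i + p j ≠ 0)
    (y s : ℂ) (i j : Fin (2 * N)) :
    HasDerivAt (fun t => solitonMatrix p a ξ₀ t s i j)
      ((vecMulVec (waveVector p ξ₀ (-1) y s) (waveVector p ξ₀ 0 y s) -
        vecMulVec (waveVector p ξ₀ 0 y s) (waveVector p ξ₀ (-1) y s)) i j) y := by
  have h : ∀ i, HasDerivAt (fun t => phase p ξ₀ i t s) (p i) y := by
    intro i
    unfold phase
    simpa using (((hasDerivAt_id y).const_mul (p i)).add_const ((p i)⁻¹ * s)).add_const (ξ₀ i)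
  refine ((((h i).fun_add (h j)).cexp.const_mul ((p i - p j) / (p i + p j))).const_add
    (if j = Fin.rev i then a i else 0)).congr_deriv ?_
  simp only [Matrix.sub_apply, vecMulVec_apply, waveVector, Complex.exp_add, neg_zero, zpow_zero,
    neg_neg, zpow_one]
  linear_combination Complex.exp (phase p ξ₀ i y s) * Complex.exp (phase p ξ₀ j y s) *
    div_mul_add hpp i j

theorem det_solitonMatrix_ne_zero (ha : ∀ i, a (Fin.rev i) = -a i) {y s : ℂ}
    (h : solitonTau p a ξ₀ y s ≠ 0) : (solitonMatrix p a ξ₀ y s).det ≠ 0 := fun hd =>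
  h (pfaffian_eq_zero_of_det_eq_zero (solitonMatrix_transpose ha y s) hd)

theorem hasDerivAt_wavePairing_s (hp : ∀ i, p i ≠ 0) (hpp : ∀ i j, i ≠ j → p i + p j ≠ 0)
    (m n : ℤ) {q : ℂ × ℂ} (hdet : (solitonMatrix p a ξ₀ q.1 q.2).det ≠ 0) :
    HasDerivAt (fun t => wavePairing p a ξ₀ m n (q.1, t))
      (wavePairing p a ξ₀ (m + 1) n q + wavePairing p a ξ₀ m (n + 1) q -
        wavePairing p a ξ₀ m 0 q * wavePairing p a ξ₀ 1 n q +
        wavePairing p a ξ₀ m 1 q * wavePairing p a ξ₀ 0 n q) q.2 :=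
  hasDerivAt_dotProduct_inv_mulVec (hasDerivAt_solitonMatrix_s hp hpp q.1 q.2)
    (hasDerivAt_waveVector_s hp m q.1 q.2) (hasDerivAt_waveVector_s hp n q.1 q.2) hdet

theorem hasDerivAt_wavePairing_y (hp : ∀ i, p i ≠ 0) (hpp : ∀ i j, i ≠ j → p i + p j ≠ 0)
    (m n : ℤ) {q : ℂ × ℂ} (hdet : (solitonMatrix p a ξ₀ q.1 q.2).det ≠ 0) :
    HasDerivAt (fun t => wavePairing p a ξ₀ m n (t, q.2))
      (wavePairing p a ξ₀ (m - 1) n q + wavePairing p a ξ₀ m (n - 1) q -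
        wavePairing p a ξ₀ m (-1) q * wavePairing p a ξ₀ 0 n q +
        wavePairing p a ξ₀ m 0 q * wavePairing p a ξ₀ (-1) n q) q.1 :=
  hasDerivAt_dotProduct_inv_mulVec (hasDerivAt_solitonMatrix_y hpp q.1 q.2)
    (hasDerivAt_waveVector_y hp m q.1 q.2) (hasDerivAt_waveVector_y hp n q.1 q.2) hdet

theorem wavePairing_swap (ha : ∀ i, a (Fin.rev i) = -a i) (m n : ℤ) {q : ℂ × ℂ}
    (hdet : (solitonMatrix p a ξ₀ q.1 q.2).det ≠ 0) :
    wavePairing p a ξ₀ n m q = -wavePairing p a ξ₀ m n q := by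
  have hinv : ((solitonMatrix p a ξ₀ q.1 q.2)⁻¹).transpose =
      -(solitonMatrix p a ξ₀ q.1 q.2)⁻¹ := by
    rw [transpose_nonsing_inv, solitonMatrix_transpose ha]
    refine inv_eq_right_inv ?_
    rw [neg_mul_neg, mul_nonsing_inv _ (isUnit_iff_ne_zero.2 hdet)]
  unfold wavePairing
  rw [dotProduct_comm, ← vecMul_transpose, hinv, vecMul_neg, neg_dotProduct, dotProduct_mulVec]

theorem wavePairing_self (ha : ∀ i, a (Fin.rev i) = -a i) (n : ℤ) {q : ℂ × ℂ}
    (hdet : (solitonMatrix p a ξ₀ q.1 q.2).det ≠ 0) : wavePairing p a ξ₀ n n q = 0 :=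
  self_eq_neg.1 (wavePairing_swap ha n n hdet)

theorem trace_inv_mul_vecMulVec (m n : ℤ) (q : ℂ × ℂ) :
    ((solitonMatrix p a ξ₀ q.1 q.2)⁻¹ *
      vecMulVec (waveVector p ξ₀ m q.1 q.2) (waveVector p ξ₀ n q.1 q.2)).trace =
      wavePairing p a ξ₀ n m q := by
  rw [mul_vecMulVec, trace_vecMulVec, dotProduct_comm, wavePairing]

theorem logS_solitonTau (hp : ∀ i, p i ≠ 0) (hpp : ∀ i j, i ≠ j → p i + p j ≠ 0)
    (ha : ∀ i, a (Fin.rev i) = -a i) {q : ℂ × ℂ} (hq : solitonTau p a ξ₀ q.1 q.2 ≠ 0) :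
    logS (solitonTau p a ξ₀) q = wavePairing p a ξ₀ 1 0 q := by
  have hdet := det_solitonMatrix_ne_zero ha hq
  have h := hasDerivAt_pfaffian (B := fun t => solitonMatrix p a ξ₀ q.1 t)
    (solitonMatrix_transpose ha q.1 q.2) (by simp [transpose_sub, transpose_vecMulVec]) hdet
    (hasDerivAt_solitonMatrix_s hp hpp q.1 q.2)
  rw [Matrix.mul_sub, trace_sub, trace_inv_mul_vecMulVec, trace_inv_mul_vecMulVec,
    wavePairing_swap ha 1 0 hdet, sub_neg_eq_add, add_self_div_two] at h
  rw [logS, lnS, logDeriv_apply]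
  change deriv (fun t => pfaffian (solitonMatrix p a ξ₀ q.1 t)) q.2 / _ = _
  rw [h.deriv]
  exact mul_div_cancel_right₀ _ hq

/-- Entry `(i, j)` of `EA + AE` is `A_ij` times `p_i⁻³ + p_j⁻³ - c (p_i⁻¹ + p_j⁻¹)`. This vanishes
for `j = rev i`, and its factor `p_i⁻¹ + p_j⁻¹` absorbs the denominator of the exponential part. The
trace against `A⁻¹` is `2 tr E`. -/
theorem wavePairing_reduction {c : ℂ} (hp : ∀ i, p i ≠ 0)
    (hpp : ∀ i j, i ≠ j → p i + p j ≠ 0) (ha : ∀ i, a (Fin.rev i) = -a i)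
    (hred : ∀ i, ((p i) ^ 3)⁻¹ + ((p (Fin.rev i)) ^ 3)⁻¹ =
      c * ((p i)⁻¹ + (p (Fin.rev i))⁻¹)) {q : ℂ × ℂ}
    (hdet : (solitonMatrix p a ξ₀ q.1 q.2).det ≠ 0) :
    wavePairing p a ξ₀ 3 0 q - 2 * wavePairing p a ξ₀ 2 1 q - c * wavePairing p a ξ₀ 1 0 q =
      ∑ i, (((p i) ^ 3)⁻¹ - c * (p i)⁻¹) := by
  set A := solitonMatrix p a ξ₀ q.1 q.2 with hA
  set E : Matrix (Fin (2 * N)) (Fin (2 * N)) ℂ :=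
    diagonal fun i => ((p i) ^ 3)⁻¹ - c * (p i)⁻¹ with hE
  set φ : ℤ → Fin (2 * N) → ℂ := fun n => waveVector p ξ₀ n q.1 q.2 with hφ
  have hu := isUnit_iff_ne_zero.2 hdet
  have key : E * A + A * E = (vecMulVec (φ 0) (φ 3) - vecMulVec (φ 3) (φ 0)) +
      (2 : ℂ) • (vecMulVec (φ 2) (φ 1) - vecMulVec (φ 1) (φ 2)) -
      c • (vecMulVec (φ 0) (φ 1) - vecMulVec (φ 1) (φ 0)) := by
    ext i j
    have hz : ∀ i, p i ^ (-2 : ℤ) = (p i)⁻¹ ^ 2 ∧ p i ^ (-3 : ℤ) = (p i)⁻¹ ^ 3 := fun i =>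
      ⟨by rw [_root_.zpow_neg, inv_pow]; rfl, by rw [_root_.zpow_neg, inv_pow]; rfl⟩
    simp only [hE, hA, hφ, Matrix.sub_apply, Matrix.add_apply, Matrix.smul_apply, smul_eq_mul,
      vecMulVec_apply, diagonal_mul, mul_diagonal, solitonMatrix, of_apply, waveVector,
      Complex.exp_add, neg_zero, zpow_zero, _root_.zpow_neg_one, (hz _).1, (hz _).2, ← inv_pow]
    have hδ : ((p i)⁻¹ ^ 3 + (p j)⁻¹ ^ 3 - c * ((p i)⁻¹ + (p j)⁻¹)) *
        (if j = Fin.rev i then a i else 0) = 0 := by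
      split_ifs with h
      · rw [h]
        have := hred i
        simp only [← inv_pow] at this
        rw [this, sub_self, zero_mul]
      · simp
    linear_combination hδ + ((p i)⁻¹ ^ 2 - (p i)⁻¹ * (p j)⁻¹ + (p j)⁻¹ ^ 2 - c) *
      Complex.exp (phase p ξ₀ i q.1 q.2) * Complex.exp (phase p ξ₀ j q.1 q.2) *
      div_mul_add_inv hp hpp i j
  have htr := congrArg (fun M => (A⁻¹ * M).trace) key
  simp only [Matrix.mul_add, Matrix.mul_sub, trace_add, trace_sub, Matrix.mul_smul, trace_smul,
    smul_eq_mul] at htr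
  rw [← Matrix.mul_assoc A⁻¹ A E, nonsing_inv_mul _ hu, Matrix.one_mul, trace_mul_comm A⁻¹,
    Matrix.mul_assoc, mul_nonsing_inv _ hu, Matrix.mul_one, hE, trace_diagonal] at htr
  simp only [hφ, hA, trace_inv_mul_vecMulVec] at htr
  rw [wavePairing_swap ha 3 0 hdet, wavePairing_swap ha 2 1 hdet,
    wavePairing_swap ha 1 0 hdet] at htr
  linear_combination -htr / 2

theorem continuous_solitonTau : Continuous fun q : ℂ × ℂ => solitonTau p a ξ₀ q.1 q.2 := by
  unfold solitonTau pfaffian solitonMatrix phase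
  simp only [of_apply]
  fun_prop

theorem contDiff_solitonTau : ContDiff ℂ ∞ fun q : ℂ × ℂ => solitonTau p a ξ₀ q.1 q.2 := by
  unfold solitonTau pfaffian solitonMatrix phase
  simp only [of_apply]
  refine contDiff_const.mul (ContDiff.sum fun σ _ => contDiff_const.mul
    (contDiff_prod fun k _ => ?_))
  fun_prop

theorem satisfiesBilinear_solitonTau {c : ℂ} (hp : ∀ i, p i ≠ 0)
    (hpp : ∀ i j, i ≠ j → p i + p j ≠ 0) (ha : ∀ i, a (Fin.rev i) = -a i)
    (hred : ∀ i, ((p i) ^ 3)⁻¹ + ((p (Fin.rev i)) ^ 3)⁻¹ =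
      c * ((p i)⁻¹ + (p (Fin.rev i))⁻¹)) :
    SatisfiesBilinear c (solitonTau p a ξ₀) := by
  set U : Set (ℂ × ℂ) := {q | solitonTau p a ξ₀ q.1 q.2 ≠ 0} with hUdef
  have hU : IsOpen U := isOpen_ne_fun continuous_solitonTau continuous_const
  have hdet : ∀ q ∈ U, (solitonMatrix p a ξ₀ q.1 q.2).det ≠ 0 := fun q hq =>
    det_solitonMatrix_ne_zero ha hq
  set W := wavePairing p a ξ₀ with hW
  have hs := fun (m n : ℤ) {q : ℂ × ℂ} (hq : q ∈ U) =>
    hasDerivAt_wavePairing_s (p := p) (a := a) (ξ₀ := ξ₀) hp hpp m n (hdet q hq)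
  have hy := fun (m n : ℤ) {q : ℂ × ℂ} (hq : q ∈ U) =>
    hasDerivAt_wavePairing_y (p := p) (a := a) (ξ₀ := ξ₀) hp hpp m n (hdet q hq)
  rw [← hW] at hs hy
  have hself : ∀ (n : ℤ), ∀ q ∈ U, W n n q = 0 := fun n q hq => wavePairing_self ha n (hdet q hq)
  have hswap : ∀ (m n : ℤ), ∀ q ∈ U, W n m q = -W m n q := fun m n q hq =>
    wavePairing_swap ha m n (hdet q hq)
  have h0 : Set.EqOn (logS (solitonTau p a ξ₀)) (W 1 0) U := fun q hq =>
    logS_solitonTau hp hpp ha hq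
  have h1 : Set.EqOn (partialS (logS (solitonTau p a ξ₀)))
      (fun q => W 2 0 q - W 1 0 q ^ 2) U := by
    refine (h0.partialS hU).trans fun q hq => ((hs 1 0 hq).congr_deriv ?_).deriv
    norm_num [hself _ q hq]
    ring
  have h2 : Set.EqOn (partialS (partialS (logS (solitonTau p a ξ₀))))
      (fun q => W 3 0 q + W 2 1 q - 3 * W 1 0 q * W 2 0 q + 2 * W 1 0 q ^ 3) U := by
    refine (h1.partialS hU).trans fun q hq =>
      (((hs 2 0 hq).sub ((hs 1 0 hq).pow 2)).congr_deriv ?_).deriv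
    norm_num [hself _ q hq]
    ring
  have hY : Set.EqOn (partialY (logS (solitonTau p a ξ₀)))
      (fun q => W 1 (-1) q - W 0 (-1) q * W 1 0 q) U := by
    refine (h0.partialY hU).trans fun q hq => ((hy 1 0 hq).congr_deriv ?_).deriv
    norm_num [hself _ q hq, hswap 0 (-1) q hq]
    ring
  intro q hq
  -- The reduced combination of pairings is constant on `U`, so its `y`-derivative vanishes.
  have hred' : HasDerivAt (fun t => W 3 0 (t, q.2) - 2 * W 2 1 (t, q.2) - c * W 1 0 (t, q.2))
      0 q.1 :=
    (hasDerivAt_const q.1 (∑ i, (((p i) ^ 3)⁻¹ - c * (p i)⁻¹))).congr_of_eventuallyEq <|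
      (hU.eventually_mk_left_mem hq).mono fun t ht =>
        wavePairing_reduction hp hpp ha hred (hdet _ ht)
  have hr := hred'.unique
    (((hy 3 0 hq).sub ((hy 2 1 hq).const_mul 2)).sub ((hy 1 0 hq).const_mul c))
  have h3 : partialY (partialS (partialS (logS (solitonTau p a ξ₀)))) q = _ :=
    (h2.partialY hU hq).trans (((((hy 3 0 hq).add (hy 2 1 hq)).sub
      (((hy 1 0 hq).const_mul 3).mul (hy 2 0 hq))).add
        (((hy 1 0 hq).pow 3).const_mul 2)).deriv)
  rw [h3, hY hq, h1 hq]
  norm_num [hself _ q hq, hswap 0 (-1) q hq, hswap 1 0 q hq, hswap 1 (-1) q hq] at hr ⊢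
  -- After skew-symmetry is used, the bilinear expression coincides with that `y`-derivative.
  linear_combination -hr

end Soliton

/-! ### The hodograph change of variables. -/

section Hodograph

variable {𝕜 : Type*} [RCLike 𝕜] {U : Set (𝕜 × 𝕜)} {f : 𝕜 × 𝕜 → 𝕜} {τ : 𝕜 → 𝕜 → 𝕜}

theorem DifferentiableAt.hasDerivAt_partialY {q : 𝕜 × 𝕜} (h : DifferentiableAt 𝕜 f q) :
    HasDerivAt (fun y => f (y, q.2)) (fderiv 𝕜 f q (1, 0)) q.1 :=
  h.hasFDerivAt.comp_hasDerivAt (f := fun y => (y, q.2)) q.1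
    ((hasDerivAt_id q.1).prodMk (hasDerivAt_const q.1 q.2))

theorem DifferentiableAt.hasDerivAt_partialS {q : 𝕜 × 𝕜} (h : DifferentiableAt 𝕜 f q) :
    HasDerivAt (fun s => f (q.1, s)) (fderiv 𝕜 f q (0, 1)) q.2 :=
  h.hasFDerivAt.comp_hasDerivAt (f := fun s => (q.1, s)) q.2
    ((hasDerivAt_const q.2 q.1).prodMk (hasDerivAt_id q.2))

theorem DifferentiableAt.partialY_eq {q : 𝕜 × 𝕜} (h : DifferentiableAt 𝕜 f q) :
    partialY f q = fderiv 𝕜 f q (1, 0) := h.hasDerivAt_partialY.deriv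

theorem DifferentiableAt.partialS_eq {q : 𝕜 × 𝕜} (h : DifferentiableAt 𝕜 f q) :
    partialS f q = fderiv 𝕜 f q (0, 1) := h.hasDerivAt_partialS.deriv

theorem ContDiffOn.differentiableAt_of_isOpen (hf : ContDiffOn 𝕜 ∞ f U) (hU : IsOpen U)
    {q : 𝕜 × 𝕜} (hq : q ∈ U) : DifferentiableAt 𝕜 f q :=
  (hf.contDiffAt (hU.mem_nhds hq)).differentiableAt (by simp)

theorem ContDiffOn.partialY (hf : ContDiffOn 𝕜 ∞ f U) (hU : IsOpen U) :
    ContDiffOn 𝕜 ∞ (partialY f) U :=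
  ((hf.fderiv_of_isOpen (m := ∞) hU (by simp)).clm_apply contDiffOn_const).congr fun _ hq =>
    (hf.differentiableAt_of_isOpen hU hq).partialY_eq

theorem ContDiffOn.partialS (hf : ContDiffOn 𝕜 ∞ f U) (hU : IsOpen U) :
    ContDiffOn 𝕜 ∞ (partialS f) U :=
  ((hf.fderiv_of_isOpen (m := ∞) hU (by simp)).clm_apply contDiffOn_const).congr fun _ hq =>
    (hf.differentiableAt_of_isOpen hU hq).partialS_eq

theorem fderiv_apply_eq_partials {q : 𝕜 × 𝕜} (h : DifferentiableAt 𝕜 f q) (v : 𝕜 × 𝕜) :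
    fderiv 𝕜 f q v = v.1 * partialY f q + v.2 * partialS f q := by
  rw [h.partialY_eq, h.partialS_eq, ← smul_eq_mul, ← smul_eq_mul, ← map_smul, ← map_smul,
    ← map_add]
  simp

theorem partialS_partialY_comm (hf : ContDiffOn 𝕜 ∞ f U) (hU : IsOpen U) {q : 𝕜 × 𝕜}
    (hq : q ∈ U) : partialS (partialY f) q = partialY (partialS f) q := by
  have hsymm : IsSymmSndFDerivAt 𝕜 f q :=
    (hf.contDiffAt (hU.mem_nhds hq)).isSymmSndFDerivAt (by
      rw [minSmoothness_of_isRCLikeNormedField]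
      exact WithTop.coe_le_coe.2 (le_top : (2 : ℕ∞) ≤ ⊤))
  have hd : DifferentiableAt 𝕜 (fderiv 𝕜 f) q :=
    ((hf.fderiv_of_isOpen (m := ∞) hU (by simp)).contDiffAt (hU.mem_nhds hq)).differentiableAt
      (by simp)
  have h1 : Set.EqOn (partialY f) (fun q => fderiv 𝕜 f q (1, 0)) U := fun _ hq =>
    (hf.differentiableAt_of_isOpen hU hq).partialY_eq
  have h2 : Set.EqOn (partialS f) (fun q => fderiv 𝕜 f q (0, 1)) U := fun _ hq =>
    (hf.differentiableAt_of_isOpen hU hq).partialS_eq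
  have happ : ∀ v, DifferentiableAt 𝕜 (fun q => fderiv 𝕜 f q v) q := fun v =>
    hd.clm_apply (differentiableAt_const v)
  have hfd : ∀ v w, fderiv 𝕜 (fun q => fderiv 𝕜 f q v) q w = fderiv 𝕜 (fderiv 𝕜 f) q w v := by
    intro v w
    rw [fderiv_clm_apply hd (differentiableAt_const v)]
    simp
  rw [h1.partialS hU hq, h2.partialY hU hq, (happ _).partialS_eq, (happ _).partialY_eq, hfd, hfd,
    hsymm.eq]

theorem contDiffOn_logS (hτ : ContDiff 𝕜 ∞ fun q : 𝕜 × 𝕜 => τ q.1 q.2) :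
    ContDiffOn 𝕜 ∞ (logS τ) {q | τ q.1 q.2 ≠ 0} := by
  have h := (hτ.contDiffOn (s := Set.univ)).partialS isOpen_univ
  exact (h.mono (Set.subset_univ _)).div hτ.contDiffOn fun q hq => hq

/-- The linear automorphism `(v, w) ↦ (α v + β w, w)` of the plane. -/
def shearEquiv (α β : 𝕜) (hα : α ≠ 0) : (𝕜 × 𝕜) ≃L[𝕜] 𝕜 × 𝕜 :=
  ContinuousLinearEquiv.equivOfInverse
    ((α • ContinuousLinearMap.fst 𝕜 𝕜 𝕜 + β • ContinuousLinearMap.snd 𝕜 𝕜 𝕜).prod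
      (ContinuousLinearMap.snd 𝕜 𝕜 𝕜))
    ((α⁻¹ • (ContinuousLinearMap.fst 𝕜 𝕜 𝕜 - β • ContinuousLinearMap.snd 𝕜 𝕜 𝕜)).prod
      (ContinuousLinearMap.snd 𝕜 𝕜 𝕜))
    (fun v => by ext <;> simp [hα]) (fun v => by ext <;> simp [hα])

theorem shearEquiv_apply (α β : 𝕜) (hα : α ≠ 0) (v : 𝕜 × 𝕜) :
    shearEquiv α β hα v = (α * v.1 + β * v.2, v.2) := rfl

theorem shearEquiv_symm_apply (α β : 𝕜) (hα : α ≠ 0) (v : 𝕜 × 𝕜) :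
    (shearEquiv α β hα).symm v = (α⁻¹ * (v.1 - β * v.2), v.2) := rfl

theorem isOpen_regularSet (hτ : ContDiff 𝕜 ∞ fun q : 𝕜 × 𝕜 => τ q.1 q.2) :
    IsOpen (regularSet τ) := by
  have hU : IsOpen {q : 𝕜 × 𝕜 | τ q.1 q.2 ≠ 0} := isOpen_ne_fun hτ.continuous continuous_const
  have hc : ContinuousOn (fun q => 1 - 2 * partialY (logS τ) q) {q : 𝕜 × 𝕜 | τ q.1 q.2 ≠ 0} :=
    (contDiffOn_const.sub (contDiffOn_const.mul
      ((contDiffOn_logS hτ).partialY hU))).continuousOn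
  exact hc.isOpen_inter_preimage hU isOpen_ne

theorem contDiffAt_hodograph (hτ : ContDiff 𝕜 ∞ fun q : 𝕜 × 𝕜 => τ q.1 q.2) {q : 𝕜 × 𝕜}
    (hq : τ q.1 q.2 ≠ 0) : ContDiffAt 𝕜 ∞ (hodograph τ) q := by
  have hU : IsOpen {q : 𝕜 × 𝕜 | τ q.1 q.2 ≠ 0} := isOpen_ne_fun hτ.continuous continuous_const
  have hl := (contDiffOn_logS hτ).contDiffAt (hU.mem_nhds hq)
  exact (contDiffAt_fst.sub (contDiffAt_const.mul hl)).prodMk contDiffAt_snd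

theorem one_sub_ne_zero_of_mem_regularSet {q : 𝕜 × 𝕜} (hq : q ∈ regularSet τ) :
    1 - 2 * partialY (logS τ) q ≠ 0 := hq.2

theorem hasFDerivAt_hodograph (hτ : ContDiff 𝕜 ∞ fun q : 𝕜 × 𝕜 => τ q.1 q.2) {q : 𝕜 × 𝕜}
    (hq : q ∈ regularSet τ) :
    HasFDerivAt (hodograph τ)
      (shearEquiv (1 - 2 * partialY (logS τ) q) (-2 * partialS (logS τ) q)
          (one_sub_ne_zero_of_mem_regularSet hq) :
        𝕜 × 𝕜 →L[𝕜] 𝕜 × 𝕜) q := by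
  have hU : IsOpen {q : 𝕜 × 𝕜 | τ q.1 q.2 ≠ 0} := isOpen_ne_fun hτ.continuous continuous_const
  have hl := (contDiffOn_logS hτ).differentiableAt_of_isOpen hU hq.1
  refine ((hasFDerivAt_fst.sub (hl.hasFDerivAt.const_mul 2)).prodMk
    hasFDerivAt_snd).congr_fderiv ?_
  refine ContinuousLinearMap.ext fun v => ?_
  rw [ContinuousLinearEquiv.coe_coe, shearEquiv_apply]
  refine Prod.ext ?_ rfl
  simp only [ContinuousLinearMap.prod_apply, sub_apply,
    smul_apply, ContinuousLinearMap.coe_fst', fderiv_apply_eq_partials hl,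
    smul_eq_mul]
  ring

/-- An injective restriction of the hodograph map to an open set of regular parameters has an
open image and a smooth inverse. -/
theorem exists_hodograph_inverse (hτ : ContDiff 𝕜 ∞ fun q : 𝕜 × 𝕜 => τ q.1 q.2)
    {W : Set (𝕜 × 𝕜)} (hW : IsOpen W) (hWR : W ⊆ regularSet τ)
    (hinj : Set.InjOn (hodograph τ) W) :
    IsOpen (hodograph τ '' W) ∧ ∃ G : 𝕜 × 𝕜 → 𝕜 × 𝕜, (∀ q ∈ W, G (hodograph τ q) = q) ∧
      ContDiffOn 𝕜 ∞ G (hodograph τ '' W) := by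
  have hG := hinj.leftInvOn_invFunOn
  set G := Function.invFunOn (hodograph τ) W
  -- Injectivity on `W` forces the set-theoretic inverse `G` to agree near each image point with the
  -- smooth local inverse.
  have key : ∀ q ∈ W, hodograph τ '' W ∈ nhds (hodograph τ q) ∧
      ContDiffAt 𝕜 ∞ G (hodograph τ q) := by
    intro q hq
    have hc := contDiffAt_hodograph hτ (hWR hq).1
    have hd := hasFDerivAt_hodograph hτ (hWR hq)
    have hn : (∞ : WithTop ℕ∞) ≠ 0 := by simp
    set Φ := hc.toOpenPartialHomeomorph (hodograph τ) hd hn with hΦ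
    have hΦq : Φ.symm (hodograph τ q) = q := hc.localInverse_apply_image hd hn
    have hsm : ContDiffAt 𝕜 ∞ Φ.symm (hodograph τ q) := hc.to_localInverse hd hn
    have htgt : ∀ᶠ z in nhds (hodograph τ q), z ∈ Φ.target :=
      Φ.open_target.mem_nhds (hc.image_mem_toOpenPartialHomeomorph_target hd hn)
    have hmem : ∀ᶠ z in nhds (hodograph τ q), Φ.symm z ∈ W :=
      hsm.continuousAt.eventually (hW.mem_nhds (by rwa [hΦq]))
    have hright : ∀ z ∈ Φ.target, hodograph τ (Φ.symm z) = z := fun z hz => Φ.right_inv hz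
    refine ⟨?_, hsm.congr_of_eventuallyEq ?_⟩
    · filter_upwards [htgt, hmem] with z hz hzW
      exact ⟨_, hzW, hright z hz⟩
    · filter_upwards [htgt, hmem] with z hz hzW
      have := hG hzW
      rwa [hright z hz] at this
  refine ⟨isOpen_iff_mem_nhds.2 ?_, G, fun q hq => hG hq, ?_⟩
  · rintro _ ⟨q, hq, rfl⟩
    exact (key q hq).1
  · rintro _ ⟨q, hq, rfl⟩
    exact (key q hq).2.contDiffWithinAt

theorem exists_injOn_hodograph (hτ : ContDiff 𝕜 ∞ fun q : 𝕜 × 𝕜 => τ q.1 q.2) {q : 𝕜 × 𝕜}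
    (hq : q ∈ regularSet τ) : ∃ W : Set (𝕜 × 𝕜),
      IsOpen W ∧ q ∈ W ∧ W ⊆ regularSet τ ∧ Set.InjOn (hodograph τ) W := by
  have hc := contDiffAt_hodograph hτ hq.1
  have hd := hasFDerivAt_hodograph hτ hq
  have hn : (∞ : WithTop ℕ∞) ≠ 0 := by simp
  set Φ := hc.toOpenPartialHomeomorph (hodograph τ) hd hn
  exact ⟨Φ.source ∩ regularSet τ, Φ.open_source.inter (isOpen_regularSet hτ),
    ⟨hc.mem_toOpenPartialHomeomorph_source hd hn, hq⟩, Set.inter_subset_right,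
    Φ.injOn.mono Set.inter_subset_left⟩

theorem partialY_const_mul (k : 𝕜) (q : 𝕜 × 𝕜) :
    partialY (fun q => k * f q) q = k * partialY f q := deriv_const_mul_field k

theorem partialS_const_mul (k : 𝕜) (q : 𝕜 × 𝕜) :
    partialS (fun q => k * f q) q = k * partialS f q := deriv_const_mul_field k

theorem isParametricSolution_of_satisfiesBilinear {c : 𝕜}
    (hτ : ContDiff 𝕜 ∞ fun q : 𝕜 × 𝕜 => τ q.1 q.2) (hbil : SatisfiesBilinear c τ) :
    IsParametricSolution c τ where
  isOpen := isOpen_regularSet hτ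
  locally_injective _ hq := exists_injOn_hodograph hτ hq
  solution W hW hWR hinj := by
    obtain ⟨hD, G, hG, hGs⟩ := exists_hodograph_inverse hτ hW hWR hinj
    have hU : IsOpen {q : 𝕜 × 𝕜 | τ q.1 q.2 ≠ 0} :=
      isOpen_ne_fun hτ.continuous continuous_const
    have hWU : W ⊆ {q : 𝕜 × 𝕜 | τ q.1 q.2 ≠ 0} := fun q hq => (hWR hq).1
    set ℓ := logS τ with hℓ
    set D := hodograph τ '' W with hDdef
    have hℓs : ContDiffOn 𝕜 ∞ ℓ W := (contDiffOn_logS hτ).mono hWU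
    set u : 𝕜 × 𝕜 → 𝕜 := fun q => -2 * partialS ℓ q with hu
    set ρ : 𝕜 × 𝕜 → 𝕜 := fun q => (1 - 2 * partialY ℓ q)⁻¹ with hρ
    have hα : ∀ q ∈ W, 1 - 2 * partialY ℓ q ≠ 0 := fun q hq => (hWR hq).2
    have hus : ContDiffOn 𝕜 ∞ u W := contDiffOn_const.mul (hℓs.partialS hW)
    have hαs : ContDiffOn 𝕜 ∞ (fun q => 1 - 2 * partialY ℓ q) W :=
      contDiffOn_const.sub (contDiffOn_const.mul (hℓs.partialY hW))
    have hρs : ContDiffOn 𝕜 ∞ ρ W := hαs.inv hα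
    have hGW : ∀ z ∈ D, G z ∈ W := by
      rintro _ ⟨q, hq, rfl⟩
      rwa [hG q hq]
    have hHG : ∀ z ∈ D, hodograph τ (G z) = z := by
      rintro _ ⟨q, hq, rfl⟩
      rw [hG q hq]
    have hGd : ∀ z (hz : z ∈ D), HasFDerivAt G
        ((shearEquiv (1 - 2 * partialY ℓ (G z)) (u (G z)) (hα _ (hGW z hz))).symm :
          𝕜 × 𝕜 →L[𝕜] 𝕜 × 𝕜) z := fun z hz =>
      HasFDerivAt.of_local_left_inverse
        ((hGs.contDiffAt (hD.mem_nhds hz)).continuousAt)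
        (hasFDerivAt_hodograph hτ (hWR (hGW z hz)))
        ((hD.eventually_mem hz).mono hHG)
    -- Chain rule: `∂_x = ρ ∂_y` and `∂_t = ∂_s - u ρ ∂_y`.
    have hcomp : ∀ {f : 𝕜 × 𝕜 → 𝕜}, ContDiffOn 𝕜 ∞ f W → ∀ z ∈ D,
        HasDerivAt (fun x => f (G (x, z.2))) (ρ (G z) * partialY f (G z)) z.1 ∧
        HasDerivAt (fun t => f (G (z.1, t)))
          (partialS f (G z) - u (G z) * ρ (G z) * partialY f (G z)) z.2 := by
      intro f hf z hz
      have hfd := hf.differentiableAt_of_isOpen hW (hGW z hz)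
      have hc := HasFDerivAt.comp z hfd.hasFDerivAt (hGd z hz)
      have h1 := hc.differentiableAt.hasDerivAt_partialY
      have h2 := hc.differentiableAt.hasDerivAt_partialS
      rw [hc.fderiv] at h1 h2
      refine ⟨h1.congr_deriv ?_, h2.congr_deriv ?_⟩
      · rw [ContinuousLinearMap.comp_apply, fderiv_apply_eq_partials hfd,
          ContinuousLinearEquiv.coe_coe, shearEquiv_symm_apply]
        simp [hρ]
      · rw [ContinuousLinearMap.comp_apply, fderiv_apply_eq_partials hfd,
          ContinuousLinearEquiv.coe_coe, shearEquiv_symm_apply]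
        simp only [hρ]
        ring
    refine ⟨fun x t => u (G (x, t)), fun x t => ρ (G (x, t)), ?_, ?_⟩
    · intro y s hq
      have : G (y - 2 * lnS τ y s, s) = (y, s) := hG (y, s) hq
      simp only [this]
      exact ⟨rfl, rfl⟩
    · refine ⟨hD, hus.comp hGs hGW, hρs.comp hGs hGW, ?_, ?_⟩
      · intro x t hz
        -- The material derivative `∂_t + u ∂_x` is `∂_s`; the equality is needed near `x` because
        -- it is differentiated again.
        have hev : (fun x' => deriv (fun t' => u (G (x', t'))) t +
            u (G (x', t)) * deriv (fun x'' => u (G (x'', t))) x') =ᶠ[nhds x]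
            fun x' => partialS u (G (x', t)) := by
          filter_upwards [hD.eventually_mk_left_mem hz] with x' hx'
          have h := hcomp hus (x', t) hx'
          rw [h.1.deriv, h.2.deriv]
          ring
        rw [hev.deriv_eq, (hcomp (hus.partialS hW) (x, t) hz).1.deriv]
        have hss : partialY (partialS u) (G (x, t)) =
            -2 * partialY (partialS (partialS ℓ)) (G (x, t)) := by
          rw [← partialY_const_mul]
          exact congrArg (fun f => partialY f (G (x, t)))
            (funext fun q => partialS_const_mul (-2) q)
        have hb := hbil (G (x, t)) (hWU (hGW _ hz))
        have ha := hα _ (hGW _ hz)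
        rw [hss]
        simp only [hu, hρ]
        rw [← hℓ] at hb
        field_simp
        -- Multiplied by `1/ρ = 1 - 2 ℓ_y`, the momentum equation is `-2` times the bilinear one.
        linear_combination -2 * hb
      · intro x t hz
        have h1 := hcomp hρs (x, t) hz
        have h2 := hcomp hus (x, t) hz
        have hmul := h1.1.mul h2.1
        have hq := hGW _ hz
        have hρS : partialS ρ (G (x, t)) =
            2 * partialS (partialY ℓ) (G (x, t)) * ρ (G (x, t)) ^ 2 := by
          have hd := ((hℓs.partialY hW).differentiableAt_of_isOpen hW hq)
          have h3 := (((hd.hasDerivAt_partialS).const_mul 2).const_sub 1).fun_inv (hα _ hq)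
          rw [← hd.partialS_eq] at h3
          refine h3.deriv.trans ?_
          rw [div_eq_mul_inv, ← inv_pow]
          simp only [hρ, Prod.mk.eta]
          ring
        have huY : partialY u (G (x, t)) = -2 * partialY (partialS ℓ) (G (x, t)) :=
          partialY_const_mul _ _
        have hm' : deriv (fun x' => ρ (G (x', t)) * u (G (x', t))) x = _ := hmul.deriv
        -- The terms in `ρ_y` cancel, and the rest is equality of the mixed derivatives of `ℓ`; the
        -- bilinear equation is not needed.
        rw [h1.2.deriv, hm', hρS, huY, partialS_partialY_comm hℓs hW hq]
        ring

end Hodograph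

/-! ### Descent to real variables. -/

section RealForm

theorem ofReal_deriv_of_eventually {f : ℝ → ℝ} {F : ℂ → ℂ} {x : ℝ}
    (h : ∀ᶠ t in nhds x, (f t : ℂ) = F t) (hF : DifferentiableAt ℂ F x) :
    ((deriv f x : ℝ) : ℂ) = deriv F x := by
  have h1 : HasDerivAt (fun t : ℝ => (f t : ℂ)) (deriv F x) x :=
    hF.hasDerivAt.comp_ofReal.congr_of_eventuallyEq h
  have h2 : HasDerivAt f (deriv F x).re x :=
    hF.hasDerivAt.real_of_complex.congr_of_eventuallyEq <| h.mono fun t ht => by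
      change f t = (F t).re
      rw [← ht, Complex.ofReal_re]
  rw [h2.deriv]
  exact h2.ofReal_comp.unique h1

/-- The inclusion of the real plane into the complex plane. -/
def ofRealPair (q : ℝ × ℝ) : ℂ × ℂ := (q.1, q.2)

variable {V : Set (ℝ × ℝ)} {f : ℝ × ℝ → ℝ} {F : ℂ × ℂ → ℂ}

theorem ofReal_partialY (hV : IsOpen V) (h : ∀ q ∈ V, (f q : ℂ) = F (ofRealPair q))
    (hF : ∀ q ∈ V, DifferentiableAt ℂ F (ofRealPair q)) :
    ∀ q ∈ V, ((partialY f q : ℝ) : ℂ) = partialY F (ofRealPair q) := fun q hq =>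
  ofReal_deriv_of_eventually ((hV.eventually_mk_left_mem hq).mono fun _ ht => h _ ht)
    (hF q hq).hasDerivAt_partialY.differentiableAt

theorem ofReal_partialS (hV : IsOpen V) (h : ∀ q ∈ V, (f q : ℂ) = F (ofRealPair q))
    (hF : ∀ q ∈ V, DifferentiableAt ℂ F (ofRealPair q)) :
    ∀ q ∈ V, ((partialS f q : ℝ) : ℂ) = partialS F (ofRealPair q) := fun q hq =>
  ofReal_deriv_of_eventually ((hV.eventually_mk_right_mem hq).mono fun _ ht => h _ ht)
    (hF q hq).hasDerivAt_partialS.differentiableAt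

variable {T : ℝ → ℝ → ℝ} {τ : ℂ → ℂ → ℂ} {g : ℂ}

theorem contDiff_real_form (hτ : ContDiff ℂ ∞ fun q : ℂ × ℂ => τ q.1 q.2)
    (hT : ∀ y s : ℝ, (T y s : ℂ) = g * τ y s) : ContDiff ℝ ∞ fun q : ℝ × ℝ => T q.1 q.2 := by
  have h1 : ContDiff ℝ ∞ ofRealPair :=
    (Complex.ofRealCLM.contDiff.comp contDiff_fst).prodMk
      (Complex.ofRealCLM.contDiff.comp contDiff_snd)
  have h2 : ContDiff ℝ ∞ fun q : ℝ × ℝ => Complex.reCLM (g * τ q.1 q.2) :=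
    Complex.reCLM.contDiff.comp (contDiff_const.mul ((hτ.restrict_scalars ℝ).comp h1))
  refine (congrArg (ContDiff ℝ ∞) (funext fun q => ?_)).mpr h2
  rw [← hT, Complex.reCLM_apply, Complex.ofReal_re]

/-- The constant `g` drops out of the logarithmic derivative, and real partial derivatives of a real
restriction are restrictions of the complex ones. -/
theorem SatisfiesBilinear.real_form {r : ℝ} (hτ : ContDiff ℂ ∞ fun q : ℂ × ℂ => τ q.1 q.2)
    (hbil : SatisfiesBilinear (r : ℂ) τ) (hg : g ≠ 0)
    (hT : ∀ y s : ℝ, (T y s : ℂ) = g * τ y s) : SatisfiesBilinear r T := by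
  have hU : IsOpen {q : ℂ × ℂ | τ q.1 q.2 ≠ 0} := isOpen_ne_fun hτ.continuous continuous_const
  set V : Set (ℝ × ℝ) := {q | T q.1 q.2 ≠ 0}
  have hV : IsOpen V := isOpen_ne_fun (contDiff_real_form hτ hT).continuous continuous_const
  have hVU : ∀ q ∈ V, τ (ofRealPair q).1 (ofRealPair q).2 ≠ 0 := by
    intro q hq h0
    refine hq (Complex.ofReal_injective ?_)
    rw [hT, Complex.ofReal_zero]
    exact mul_eq_zero_of_right g h0
  have hdiff : ∀ {F : ℂ × ℂ → ℂ}, ContDiffOn ℂ ∞ F {q | τ q.1 q.2 ≠ 0} →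
      ∀ q ∈ V, DifferentiableAt ℂ F (ofRealPair q) := fun hF q hq =>
    hF.differentiableAt_of_isOpen hU (hVU q hq)
  have hl := contDiffOn_logS hτ
  have h0 : ∀ q ∈ V, ((logS T q : ℝ) : ℂ) = logS τ (ofRealPair q) := by
    intro q hq
    have hd : DifferentiableAt ℂ (fun s => τ q.1 s) q.2 :=
      (hτ.contDiffAt.differentiableAt (by simp) :
        DifferentiableAt ℂ _ (ofRealPair q)).hasDerivAt_partialS.differentiableAt
    have h := ofReal_deriv_of_eventually (f := fun s => T q.1 s) (F := fun s => g * τ q.1 s)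
      (x := q.2) (Filter.Eventually.of_forall fun s => hT q.1 s) (hd.const_mul g)
    rw [logS, lnS, logDeriv_apply, Complex.ofReal_div, h, hT, deriv_const_mul_field,
      mul_div_mul_left _ _ hg]
    rfl
  have hS := ofReal_partialS hV h0 (hdiff hl)
  have hSS := ofReal_partialS hV hS (hdiff (hl.partialS hU))
  have hSSY := ofReal_partialY hV hSS (hdiff ((hl.partialS hU).partialS hU))
  have hY := ofReal_partialY hV h0 (hdiff hl)
  intro q hq
  have h := hbil (ofRealPair q) (hVU q hq)
  rw [← hSSY q hq, ← hS q hq, ← hY q hq] at h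
  exact_mod_cast h

end RealForm

theorem theorem1 (N : ℕ) (c : ℂ) (p a ξ₀ : Fin (2 * N) → ℂ)
    (hp : ∀ i, p i ≠ 0)
    (hpp : ∀ i j, i ≠ j → p i + p j ≠ 0)
    (ha : ∀ i, a (Fin.rev i) = -a i)
    (hred : ∀ i, ((p i) ^ 3)⁻¹ + ((p (Fin.rev i)) ^ 3)⁻¹ =
      c * ((p i)⁻¹ + (p (Fin.rev i))⁻¹)) :
    IsParametricSolution c (solitonTau p a ξ₀) ∧
    ∀ (r : ℝ) (g : ℂ) (T : ℝ → ℝ → ℝ), c = (r : ℂ) → g ≠ 0 →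
      (∀ y s : ℝ, (T y s : ℂ) = g * solitonTau p a ξ₀ (y : ℂ) (s : ℂ)) →
      IsParametricSolution r T := by
  have hbil : SatisfiesBilinear c (solitonTau p a ξ₀) :=
    satisfiesBilinear_solitonTau hp hpp ha hred
  refine ⟨isParametricSolution_of_satisfiesBilinear contDiff_solitonTau hbil, ?_⟩
  rintro r g T rfl hg hT
  exact isParametricSolution_of_satisfiesBilinear (contDiff_real_form contDiff_solitonTau hT)
    (hbil.real_form contDiff_solitonTau hg hT)
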